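/- Let $A$ be a non-zero abelian C$^*$-algebra, let $A\overline\otimes A$ be a C$^*$-tensor product of $A$ with itself (a completion of the algebraic tensor product $A\otimes A$ in a C$^*$-norm), and let $M(\cdot)$ denote the multiplier algebra. Let $\Delta : A\to M(A\overline\otimes A)$ be a comultiplication on $A$, that is, a $^*$-homomorphism which is non-degenerate (the linear span $\Delta(A)(A\otimes A)$ of the elements $\Delta(a)(b\otimes c)$ is dense in $A\overline\otimes A$) and coassociative, $(\Delta\otimes\iota)\Delta=(\iota\otimes\Delta)\Delta$, where $\iota$ is the identity map of $A$ and $\Delta\otimes\iota$, $\iota\otimes\Delta$ stand for their unique extensions to $^*$-homomorphisms $M(A\overline\otimes A)\to M(A\overline\otimes A\overline\otimes A)$. Assume that $\Delta(a)(1\otimes b)\in A\overline\otimes A$ and $\Delta(a)(b\otimes 1)\in A\overline\otimes A$ for all $a,b\in A$, and that for all $a,b\in A$ $$\Delta(a)(1\otimes b)=0\ \Rightarrow\ a\otimes b=0,\qquad \Delta(a)(b\otimes 1)=0\ \Rightarrow\ a\otimes b=0 .$$ Then there are a locally compact Hausdorff topological group $G$ and a $^*$-isomorphism $A\cong C_0(G)$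 such that, under the induced identifications $A\overline\otimes A\cong C_0(G\times G)$ and $M(A\overline\otimes A)\cong C_b(G\times G)$, the comultiplication is given by the multiplication of $G$: $(\Delta(f))(s,t)=f(st)$ for all $f\in A$ and $s,t\in G$. -/

import Mathlib

open scoped TensorProduct MultiplierAlgebra ZeroAtInfty

universe u v w

section CStarTensorProducts

/-- A C⋆-tensor product of the C⋆-algebras `A` and `B`, realised on the C⋆-algebra `T`: a
⋆-homomorphism from the algebraic tensor product `A ⊗ B` into the C⋆-algebra `T` which is injective
and has dense range. Equivalently, `T` is a completion of the ⋆-algebra `A ⊗ B` with respect to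
some C⋆-norm (no choice of the C⋆-norm is made). -/
structure CStarTensor (A : Type u) (B : Type v) (T : Type w) [NonUnitalCStarAlgebra A]
    [NonUnitalCStarAlgebra B] [NonUnitalCStarAlgebra T] where
  /-- the inclusion of the algebraic tensor product -/
  incl : A ⊗[ℂ] B →⋆ₙₐ[ℂ] T
  injective : Function.Injective incl
  dense : DenseRange incl

namespace CStarTensor

variable {A : Type u} {B : Type v} {T : Type w} [NonUnitalCStarAlgebra A]
    [NonUnitalCStarAlgebra B] [NonUnitalCStarAlgebra T]

/-- The algebraic tensor product of left multiplications, `x ↦ (m ⊗ n) x` on `A ⊗ B`. -/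
noncomputable def algL (m : 𝓜(ℂ, A)) (n : 𝓜(ℂ, B)) : A ⊗[ℂ] B →ₗ[ℂ] A ⊗[ℂ] B :=
  TensorProduct.map (m.fst : A →ₗ[ℂ] A) (n.fst : B →ₗ[ℂ] B)

/-- The algebraic tensor product of right multiplications, `x ↦ x (m ⊗ n)` on `A ⊗ B`. -/
noncomputable def algR (m : 𝓜(ℂ, A)) (n : 𝓜(ℂ, B)) : A ⊗[ℂ] B →ₗ[ℂ] A ⊗[ℂ] B :=
  TensorProduct.map (m.snd : A →ₗ[ℂ] A) (n.snd : B →ₗ[ℂ] B)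

@[simp] theorem algL_tmul (m : 𝓜(ℂ, A)) (n : 𝓜(ℂ, B)) (a : A) (b : B) :
    algL m n (a ⊗ₜ b) = m.fst a ⊗ₜ n.fst b := rfl

@[simp] theorem algR_tmul (m : 𝓜(ℂ, A)) (n : 𝓜(ℂ, B)) (a : A) (b : B) :
    algR m n (a ⊗ₜ b) = m.snd a ⊗ₜ n.snd b := rfl

theorem algR_mul (m : 𝓜(ℂ, A)) (n : 𝓜(ℂ, B)) (x y : A ⊗[ℂ] B) :
    algR m n x * y = x * algL m n y := by
  induction x with
  | zero => simp
  | add x₁ x₂ h₁ h₂ => simp only [map_add, add_mul, h₁, h₂]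
  | tmul a b =>
    induction y with
    | zero => simp
    | add y₁ y₂ h₁ h₂ => simp only [map_add, mul_add, h₁, h₂]
    | tmul c d => simp [m.central, n.central]

theorem star_algL (m : 𝓜(ℂ, A)) (n : 𝓜(ℂ, B)) (x : A ⊗[ℂ] B) :
    star (algL m n x) = algR (star m) (star n) (star x) := by
  induction x with
  | zero => simp
  | add x₁ x₂ h₁ h₂ => simp only [map_add, star_add, h₁, h₂]
  | tmul a b => simp

theorem algL_algL (m m' : 𝓜(ℂ, A)) (n n' : 𝓜(ℂ, B)) (x : A ⊗[ℂ] B) :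
    algL m n (algL m' n' x) = algL (m * m') (n * n') x := by
  induction x with
  | zero => simp
  | add x₁ x₂ h₁ h₂ => simp only [map_add, h₁, h₂]
  | tmul a b => simp

theorem star_algL_mul_self (m : 𝓜(ℂ, A)) (n : 𝓜(ℂ, B)) (x : A ⊗[ℂ] B) :
    star (algL m n x) * algL m n x = star x * algL (star m * m) (star n * n) x := by
  rw [star_algL, algR_mul, algL_algL]

theorem exists_star_mul_self_add {M : Type*} [CStarAlgebra M] (m : M) :
    ∃ c : M, star m * m + star c * c = ((‖m‖ ^ 2 : ℝ) : ℂ) • (1 : M) := by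
  let _ := CStarAlgebra.spectralOrder M
  let _ := CStarAlgebra.spectralOrderedRing M
  have h : star m * m ≤ algebraMap ℝ M (‖m‖ ^ 2) := CStarAlgebra.star_mul_le_algebraMap_norm_sq
  obtain ⟨c, hc⟩ := CStarAlgebra.nonneg_iff_eq_star_mul_self.1 (sub_nonneg.2 h)
  refine ⟨c, ?_⟩
  rw [← hc, Algebra.algebraMap_eq_smul_one, Complex.coe_smul, add_sub_cancel]

variable (t : CStarTensor A B T)

theorem norm_incl_le_of_add_eq (x y z : A ⊗[ℂ] B) (r : ℝ) (hr : 0 ≤ r)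
    (h : star y * y + star z * z = ((r ^ 2 : ℝ) : ℂ) • (star x * x)) :
    ‖t.incl y‖ ≤ r * ‖t.incl x‖ := by
  let _ := CStarAlgebra.spectralOrder T
  let _ := CStarAlgebra.spectralOrderedRing T
  have h' : star (t.incl y) * t.incl y + star (t.incl z) * t.incl z
      = ((r ^ 2 : ℝ) : ℂ) • (star (t.incl x) * t.incl x) := by
    have := congrArg t.incl h
    simpa only [map_add, map_mul, map_star, map_smul] using this
  have hle : star (t.incl y) * t.incl y ≤ ((r ^ 2 : ℝ) : ℂ) • (star (t.incl x) * t.incl x) := by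
    rw [← h']
    exact le_add_of_nonneg_right (star_mul_self_nonneg _)
  have hn := CStarAlgebra.norm_le_norm_of_nonneg_of_le (star_mul_self_nonneg _) hle
  rw [norm_smul, CStarRing.norm_star_mul_self, CStarRing.norm_star_mul_self, Complex.norm_real,
    Real.norm_of_nonneg (sq_nonneg r)] at hn
  exact abs_le_of_sq_le_sq' (by nlinarith) (by positivity) |>.2

theorem norm_incl_algL_le (m : 𝓜(ℂ, A)) (n : 𝓜(ℂ, B)) (x : A ⊗[ℂ] B) :
    ‖t.incl (algL m n x)‖ ≤ ‖m‖ * ‖n‖ * ‖t.incl x‖ := by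
  have h₁ : ∀ y, ‖t.incl (algL m (1 : 𝓜(ℂ, B)) y)‖ ≤ ‖m‖ * ‖t.incl y‖ := by
    intro y
    obtain ⟨c, hc⟩ := exists_star_mul_self_add m
    refine t.norm_incl_le_of_add_eq y _ (algL c 1 y) _ (norm_nonneg _) ?_
    rw [star_algL_mul_self, star_algL_mul_self, ← mul_add, ← mul_smul_comm]
    congr 1
    rw [star_one, one_mul]
    have e : algL (star m * m) (1 : 𝓜(ℂ, B)) + algL (star c * c) 1
        = algL (star m * m + star c * c) 1 := by
      ext a b; simp [TensorProduct.add_tmul]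
    rw [← LinearMap.add_apply, e, hc]
    have e' : algL (((‖m‖ ^ 2 : ℝ) : ℂ) • (1 : 𝓜(ℂ, A))) (1 : 𝓜(ℂ, B))
        = ((‖m‖ ^ 2 : ℝ) : ℂ) • LinearMap.id := by
      ext a b; simp [TensorProduct.smul_tmul']
    rw [e']; rfl
  have h₂ : ∀ y, ‖t.incl (algL (1 : 𝓜(ℂ, A)) n y)‖ ≤ ‖n‖ * ‖t.incl y‖ := by
    intro y
    obtain ⟨c, hc⟩ := exists_star_mul_self_add n
    refine t.norm_incl_le_of_add_eq y _ (algL 1 c y) _ (norm_nonneg _) ?_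
    rw [star_algL_mul_self, star_algL_mul_self, ← mul_add, ← mul_smul_comm]
    congr 1
    rw [star_one, one_mul]
    have e : algL (1 : 𝓜(ℂ, A)) (star n * n) + algL 1 (star c * c)
        = algL 1 (star n * n + star c * c) := by
      ext a b; simp [TensorProduct.tmul_add]
    rw [← LinearMap.add_apply, e, hc]
    have e' : algL (1 : 𝓜(ℂ, A)) (((‖n‖ ^ 2 : ℝ) : ℂ) • (1 : 𝓜(ℂ, B)))
        = ((‖n‖ ^ 2 : ℝ) : ℂ) • LinearMap.id := by
      ext a b; simp
    rw [e']; rfl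
  have e : algL m n x = algL m (1 : 𝓜(ℂ, B)) (algL (1 : 𝓜(ℂ, A)) n x) := by
    rw [algL_algL, mul_one, one_mul]
  rw [e, mul_assoc]
  exact (h₁ _).trans (mul_le_mul_of_nonneg_left (h₂ _) (norm_nonneg _))

theorem norm_incl_algR_le (m : 𝓜(ℂ, A)) (n : 𝓜(ℂ, B)) (x : A ⊗[ℂ] B) :
    ‖t.incl (algR m n x)‖ ≤ ‖m‖ * ‖n‖ * ‖t.incl x‖ := by
  have h := t.norm_incl_algL_le (star m) (star n) (star x)
  rw [← norm_star, ← map_star, star_algL] at h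
  simpa only [star_star, norm_star, map_star] using h

/-- The inclusion as a linear map. -/
noncomputable def inclₗ : A ⊗[ℂ] B →ₗ[ℂ] T where
  toFun := t.incl
  map_add' := map_add t.incl
  map_smul' := map_smul t.incl

/-- For multipliers `m ∈ M(A)` and `n ∈ M(B)`, the multiplier `m ⊗ n` of the C⋆-tensor product:
the continuous extensions of `a ⊗ b ↦ m a ⊗ n b` and `a ⊗ b ↦ a m ⊗ b n`. -/
noncomputable def mult (m : 𝓜(ℂ, A)) (n : 𝓜(ℂ, B)) : 𝓜(ℂ, T) where
  fst := (t.inclₗ ∘ₗ algL m n).extendOfNorm t.inclₗ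
  snd := (t.inclₗ ∘ₗ algR m n).extendOfNorm t.inclₗ
  central := by
    have hL := LinearMap.extendOfNorm_eq (f := t.inclₗ ∘ₗ algL m n) (e := t.inclₗ) t.dense
      ⟨_, t.norm_incl_algL_le m n⟩
    have hR := LinearMap.extendOfNorm_eq (f := t.inclₗ ∘ₗ algR m n) (e := t.inclₗ) t.dense
      ⟨_, t.norm_incl_algR_le m n⟩
    refine fun x y => t.dense.induction_on₂ (p := fun x y =>
      (t.inclₗ ∘ₗ algR m n).extendOfNorm t.inclₗ x * y
        = x * (t.inclₗ ∘ₗ algL m n).extendOfNorm t.inclₗ y)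
      (isClosed_eq (by fun_prop) (by fun_prop)) (fun a b => ?_) x y
    have hL' := hL b
    have hR' := hR a
    change _ = t.incl _ at hL' hR'
    change _ * t.incl b = t.incl a * _
    erw [hL', hR']
    rw [← map_mul, ← map_mul]
    exact congrArg t.incl (algR_mul m n a b)

theorem mult_fst_incl (m : 𝓜(ℂ, A)) (n : 𝓜(ℂ, B)) (a : A) (b : B) :
    (t.mult m n).fst (t.incl (a ⊗ₜ b)) = t.incl (m.fst a ⊗ₜ n.fst b) :=
  LinearMap.extendOfNorm_eq (f := t.inclₗ ∘ₗ algL m n) (e := t.inclₗ) t.dense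
      ⟨_, t.norm_incl_algL_le m n⟩ (a ⊗ₜ b)

theorem mult_snd_incl (m : 𝓜(ℂ, A)) (n : 𝓜(ℂ, B)) (a : A) (b : B) :
    (t.mult m n).snd (t.incl (a ⊗ₜ b)) = t.incl (m.snd a ⊗ₜ n.snd b) :=
  LinearMap.extendOfNorm_eq (f := t.inclₗ ∘ₗ algR m n) (e := t.inclₗ) t.dense
      ⟨_, t.norm_incl_algR_le m n⟩ (a ⊗ₜ b)

end CStarTensor

/-- A threefold C⋆-tensor product of `A`, realised on `S`, extending the C⋆-tensor product `t` of
`A` with itself: `S` is a C⋆-tensor product of `A ⊗̄ A` with `A` as well as one of `A` with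
`A ⊗̄ A`, and `(a ⊗ b) ⊗ c = a ⊗ (b ⊗ c)`. -/
structure CStarTripleTensor {A : Type u} {T : Type v} [NonUnitalCStarAlgebra A]
    [NonUnitalCStarAlgebra T] (t : CStarTensor A A T) (S : Type w) [NonUnitalCStarAlgebra S] where
  /-- `S` as a completion of `(A ⊗̄ A) ⊗ A` -/
  left : CStarTensor T A S
  /-- `S` as a completion of `A ⊗ (A ⊗̄ A)` -/
  right : CStarTensor A T S
  assoc : ∀ a b c : A,
    left.incl (t.incl (a ⊗ₜ b) ⊗ₜ c) = right.incl (a ⊗ₜ t.incl (b ⊗ₜ c))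

end CStarTensorProducts

section Comultiplication

variable {A : Type u} {T : Type v} {S : Type w} [NonUnitalCommCStarAlgebra A]
    [NonUnitalCStarAlgebra T] [NonUnitalCStarAlgebra S]

/-- `Δ : A → M(A ⊗̄ A)` is non-degenerate: `Δ(A)(A ⊗ A)`, the linear span of the elements
`Δ(a)(b ⊗ c)`, is dense in `A ⊗̄ A`. Here `m.fst x` is the product `m x ∈ A ⊗̄ A` of a multiplier `m`
and an element `x` of `A ⊗̄ A`. -/
def IsNondegenerateComult (t : CStarTensor A A T) (Δ : A →⋆ₙₐ[ℂ] 𝓜(ℂ, T)) : Prop :=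
  Dense ((Submodule.span ℂ {y : T | ∃ a b c : A, y = (Δ a).fst (t.incl (b ⊗ₜ c))} :
    Submodule ℂ T) : Set T)

/-- `Φ : M(A ⊗̄ A) → M(A ⊗̄ A ⊗̄ A)` is the extension of `Δ ⊗ ι`: a ⋆-homomorphism with
`Φ(a ⊗ b) = Δ(a) ⊗ b`. -/
def ExtendsComultId {t : CStarTensor A A T} (t₃ : CStarTripleTensor t S)
    (Δ : A →⋆ₙₐ[ℂ] 𝓜(ℂ, T)) (Φ : 𝓜(ℂ, T) →⋆ₙₐ[ℂ] 𝓜(ℂ, S)) : Prop :=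
  ∀ a b : A, Φ (t.incl (a ⊗ₜ b) : T) = t₃.left.mult (Δ a) (b : 𝓜(ℂ, A))

/-- `Φ : M(A ⊗̄ A) → M(A ⊗̄ A ⊗̄ A)` is the extension of `ι ⊗ Δ`: a ⋆-homomorphism with
`Φ(a ⊗ b) = a ⊗ Δ(b)`. -/
def ExtendsIdComult {t : CStarTensor A A T} (t₃ : CStarTripleTensor t S)
    (Δ : A →⋆ₙₐ[ℂ] 𝓜(ℂ, T)) (Φ : 𝓜(ℂ, T) →⋆ₙₐ[ℂ] 𝓜(ℂ, S)) : Prop :=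
  ∀ a b : A, Φ (t.incl (a ⊗ₜ b) : T) = t₃.right.mult (a : 𝓜(ℂ, A)) (Δ b)

/-- A comultiplication on the abelian C⋆-algebra `A`: a non-degenerate ⋆-homomorphism
`Δ : A → M(A ⊗̄ A)` which is coassociative, `(Δ ⊗ ι) Δ = (ι ⊗ Δ) Δ`. For abelian `A` and
non-degenerate `Δ` the extensions `Φ₁` of `Δ ⊗ ι` and `Φ₂` of `ι ⊗ Δ` to ⋆-homomorphisms
`M(A ⊗̄ A) → M(A ⊗̄ A ⊗̄ A)` exist and are unique, so that the quantifier ranges over exactly one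
pair; their existence is not assumed here. -/
structure IsComultiplication (t : CStarTensor A A T) (t₃ : CStarTripleTensor t S)
    (Δ : A →⋆ₙₐ[ℂ] 𝓜(ℂ, T)) : Prop where
  nondegenerate : IsNondegenerateComult t Δ
  coassoc : ∀ Φ₁ Φ₂ : 𝓜(ℂ, T) →⋆ₙₐ[ℂ] 𝓜(ℂ, S), ExtendsComultId t₃ Δ Φ₁ →
    ExtendsIdComult t₃ Δ Φ₂ → ∀ a : A, Φ₁ (Δ a) = Φ₂ (Δ a)

end Comultiplication

/-!
Let `Â` be the character space of `A`, a locally compact Hausdorff space on which `A` becomes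
`C₀(Â)` by the Gelfand transform. The group of the theorem is `Â` itself, with the convolution
`p * q = (p ⊗ q) ∘ Δ`.

For this to make sense, characters of `A ⊗̄ A` have to be pairs of characters of `A`, whatever the
C⋆-norm. A character of a C⋆-tensor product factors as `p ⊗ q`, and `χ ↦ (p, q)` is continuous,
injective and proper; its range is therefore closed. An open box missed by it would carry an
elementary tensor `a ⊗ b ≠ 0` on which all characters vanish, against the injectivity of
`A ⊗ B → A ⊗̄ B`. So the map is a homeomorphism (`CStarTensor.charHomeo`).

A character of a C⋆-algebra extends uniquely to the multiplier algebra
(`WeakDual.CharacterSpace.extend`), and over a commutative C⋆-algebra multipliers are the same as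
bounded continuous functions on the character space (`DoubleCentralizer.eq_of_forall_extend`,
`exists_multiplier`). Non-degeneracy of `Δ` gives that `(p ⊗ q) ∘ Δ` is not zero. The extensions of
`Δ ⊗ ι` and `ι ⊗ Δ` exist as pull-backs of bounded functions along `(p, q, r) ↦ (p * q, r)` and
`(p, q, r) ↦ (p, q * r)`, so that coassociativity of `Δ` is associativity of the convolution
(`IsComultiplication.conv_assoc`).

Finally `Δ(a)(1 ⊗ b)` is the function `(p, q) ↦ (p * q)(a) q(b)`. That it vanishes at infinity for
all `a` and `b` says that the shear map `(p, q) ↦ (p * q, q)` is proper, and the injectivity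
condition says that its range is dense; as the range is closed, the shear map is surjective. The
same holds for `(p, q) ↦ (p * q, p)`. Hence all equations `x * a = b` and `a * y = b` are
solvable in the semigroup `Â`, which is thus a group. The shear map is then a proper continuous
bijection, hence a homeomorphism, and its inverse `(s, q) ↦ (s * q⁻¹, q)` shows that inversion is
continuous (`exists_group_of_shear`).
-/

open WeakDual Filter Topology WeakDual.CharacterSpace

/-! ### Characters of a non-unital C⋆-algebra -/

section Gelfand

variable {A : Type*} [NonUnitalCStarAlgebra A]

/-- Automatic continuity of characters, from the unital case by way of the unitization. -/
theorem NonUnitalAlgHom.norm_apply_le_norm (f : A →ₙₐ[ℂ] ℂ) (a : A) : ‖f a‖ ≤ ‖a‖ := by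
  have h := AlgHom.norm_apply_le_self (Unitization.lift f) (a : Unitization ℂ A)
  simpa [Unitization.norm_inr] using h

theorem NonUnitalAlgHom.map_star_complex (f : A →ₙₐ[ℂ] ℂ) (a : A) : f (star a) = star (f a) := by
  have h := map_star (Unitization.lift f) (a : Unitization ℂ A)
  rw [← Unitization.inr_star] at h
  simpa using h

namespace WeakDual.CharacterSpace

/-- The character given by a non-zero multiplicative functional; continuity is automatic. -/
noncomputable def ofHom (f : A →ₙₐ[ℂ] ℂ) (hf : ∃ a, f a ≠ 0) : characterSpace ℂ A :=
  ⟨(LinearMap.mkContinuous (f : A →ₗ[ℂ] ℂ) 1 fun a => by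
      simpa using f.norm_apply_le_norm a : A →L[ℂ] ℂ), by
    obtain ⟨a, ha⟩ := hf
    exact ⟨fun h => ha (DFunLike.congr_fun h a), fun x y => map_mul f x y⟩⟩

theorem norm_apply_le (χ : characterSpace ℂ A) (a : A) : ‖χ a‖ ≤ ‖a‖ :=
  (toNonUnitalAlgHom χ).norm_apply_le_norm a

theorem apply_star (χ : characterSpace ℂ A) (a : A) : χ (star a) = star (χ a) :=
  (toNonUnitalAlgHom χ).map_star_complex a

theorem exists_apply_ne_zero (χ : characterSpace ℂ A) : ∃ a, χ a ≠ 0 := by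
  by_contra! h
  exact χ.2.1 (ContinuousLinearMap.ext h)

@[fun_prop]
theorem continuous_eval_apply (a : A) : Continuous fun χ : characterSpace ℂ A => χ a :=
  (WeakDual.eval_continuous a).comp continuous_subtype_val

theorem continuous_of_apply {Y : Type*} [TopologicalSpace Y] {f : Y → characterSpace ℂ A}
    (h : ∀ a, Continuous fun y => f y a) : Continuous f :=
  (WeakDual.continuous_of_continuous_eval h).subtype_mk _

variable (A) in
theorem isCompact_union_zero : IsCompact (characterSpace ℂ A ∪ {0}) := by
  refine (WeakDual.isCompact_closedBall (0 : StrongDual ℂ A) 1).of_isClosed_subset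
    (union_zero_isClosed ℂ A) fun φ hφ => ?_
  rw [Set.mem_preimage, mem_closedBall_zero_iff]
  refine ContinuousLinearMap.opNorm_le_bound _ zero_le_one fun a => ?_
  rw [one_mul]
  rcases hφ with hφ | rfl
  · exact norm_apply_le ⟨φ, hφ⟩ a
  · exact norm_zero.trans_le (norm_nonneg a)

theorem isCompact_le_norm_apply (a : A) {ε : ℝ} (hε : 0 < ε) :
    IsCompact {χ : characterSpace ℂ A | ε ≤ ‖χ a‖} := by
  rw [Subtype.isCompact_iff]
  have h : ((↑) '' {χ : characterSpace ℂ A | ε ≤ ‖χ a‖} : Set (WeakDual ℂ A))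
      = (characterSpace ℂ A ∪ {0}) ∩ {φ | ε ≤ ‖φ a‖} := by
    ext φ
    constructor
    · rintro ⟨χ, hχ, rfl⟩
      exact ⟨Or.inl χ.2, hχ⟩
    · rintro ⟨hφ | rfl, h⟩
      · exact ⟨⟨φ, hφ⟩, h, rfl⟩
      · have h0 : ε ≤ ‖(0 : ℂ)‖ := h
        exact absurd h0 (by simpa using hε)
  rw [h]
  exact (isCompact_union_zero A).inter_right
    (isClosed_le continuous_const (WeakDual.eval_continuous a).norm)

instance : LocallyCompactSpace (characterSpace ℂ A) := by
  have : WeaklyLocallyCompactSpace (characterSpace ℂ A) := ⟨fun χ => by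
    obtain ⟨a, ha⟩ := exists_apply_ne_zero χ
    have ha' : 0 < ‖χ a‖ := norm_pos_iff.2 ha
    refine ⟨_, isCompact_le_norm_apply a (half_pos ha'), ?_⟩
    filter_upwards [(continuous_eval_apply a).norm.continuousAt.eventually_const_lt
      (half_lt_self ha')] with ψ hψ using hψ.le⟩
  infer_instance

theorem tendsto_apply_cocompact (a : A) :
    Tendsto (fun χ : characterSpace ℂ A => χ a) (cocompact _) (𝓝 0) := by
  rw [Metric.tendsto_nhds]
  intro ε hε
  filter_upwards [(isCompact_le_norm_apply a hε).compl_mem_cocompact] with χ hχ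
  simpa using hχ

end WeakDual.CharacterSpace

variable (A) in
/-- The Gelfand transform of a (possibly non-unital) C⋆-algebra, as a map into the algebra of
continuous functions vanishing at infinity on the character space. -/
noncomputable def gelfandZeroAtInfty : A →⋆ₙₐ[ℂ] C₀(characterSpace ℂ A, ℂ) where
  toFun a :=
    { toFun := fun χ => χ a
      continuous_toFun := continuous_eval_apply a
      zero_at_infty' := tendsto_apply_cocompact a }
  map_smul' c a := by ext χ; exact map_smul χ c a
  map_zero' := by ext χ; exact map_zero χ
  map_add' a b := by ext χ; exact map_add χ a b
  map_mul' a b := by ext χ; exact map_mul χ a b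
  map_star' a := by ext χ; exact apply_star χ a

section CommGelfand
variable {A : Type*} [NonUnitalCommCStarAlgebra A]

theorem eq_zero_of_forall_character {a : A}
    (h : ∀ χ : characterSpace ℂ A, χ a = 0) : a = 0 := by
  have h' : gelfandTransform ℂ (Unitization ℂ A) (a : Unitization ℂ A) = 0 := by
    ext ω
    by_cases hω : ∃ b : A, ω (b : Unitization ℂ A) ≠ 0
    · exact h (ofHom ((toNonUnitalAlgHom ω).comp (Unitization.inrNonUnitalAlgHom ℂ A)) hω)
    · push Not at hω
      exact hω a
  have := (gelfandTransform_isometry (Unitization ℂ A)).injective (h'.trans (map_zero _).symm)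
  exact Unitization.inr_injective this

theorem exists_forall_character_eq (f : C₀(characterSpace ℂ A, ℂ)) :
    ∃ a : A, ∀ χ : characterSpace ℂ A, χ a = f χ := by
  classical
  let A₁ := Unitization ℂ A
  let r (ω : characterSpace ℂ A₁) : A →ₙₐ[ℂ] ℂ :=
    (toNonUnitalAlgHom ω).comp (Unitization.inrNonUnitalAlgHom ℂ A)
  -- `f`, extended by zero to the point at infinity
  let F (ω : characterSpace ℂ A₁) : ℂ :=
    if hω : ∃ b : A, r ω b ≠ 0 then f (ofHom (r ω) hω) else 0
  have hrc (b : A) : Continuous fun ω => r ω b := continuous_eval_apply (b : A₁)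
  have hF : Continuous F := by
    refine continuous_iff_continuousAt.2 fun ω₀ => ?_
    by_cases hω₀ : ∃ b : A, r ω₀ b ≠ 0
    · have hU : IsOpen {ω | ∃ b : A, r ω b ≠ 0} := by
        rw [Set.ofPred_exists]
        exact isOpen_iUnion fun b => isOpen_ne_fun (hrc b) continuous_const
      refine ContinuousOn.continuousAt ?_ (hU.mem_nhds hω₀)
      rw [continuousOn_iff_continuous_domRestrict]
      have hg : Continuous fun ω : {ω | ∃ b : A, r ω b ≠ 0} => f (ofHom (r ω) ω.2) :=
        (map_continuous f).comp
          (continuous_of_apply fun b => (hrc b).comp continuous_subtype_val)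
      refine hg.congr fun ω => ?_
      have e : F ω = f (ofHom (r ω) ω.2) := dif_pos ω.2
      exact e.symm
    · have hF₀ : F ω₀ = 0 := dif_neg hω₀
      push Not at hω₀
      rw [ContinuousAt, hF₀, Metric.tendsto_nhds]
      intro ε hε
      -- A compact set of characters of `A` stays away from the character at infinity
      have hK (K : Set (characterSpace ℂ A)) (hK : IsCompact K) :
          ∀ᶠ ω in 𝓝 ω₀, ∀ χ ∈ K, ¬ ∀ b, χ b = r ω b := by
        refine hK.induction_on (by simp) (fun s t hst ht => ?_) (fun s t hs ht => ?_)
          fun χ _ => ?_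
        · filter_upwards [ht] with ω h χ hχ using h χ (hst hχ)
        · filter_upwards [hs, ht] with ω h h' χ hχ using hχ.elim (h χ) (h' χ)
        · obtain ⟨a, ha⟩ := exists_apply_ne_zero χ
          have ha' : 0 < ‖χ a‖ := norm_pos_iff.2 ha
          refine ⟨{ψ | ‖χ a‖ / 2 < ‖ψ a‖}, mem_nhdsWithin_of_mem_nhds
            ((continuous_eval_apply a).norm.continuousAt.eventually_const_lt (half_lt_self ha')), ?_⟩
          have h0 : ‖r ω₀ a‖ < ‖χ a‖ / 2 := by rw [hω₀ a, norm_zero]; exact half_pos ha'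
          filter_upwards [(hrc a).norm.continuousAt.eventually_lt_const h0] with ω hω ψ hψ h
          rw [← h a] at hω
          exact lt_asymm hω hψ
      obtain ⟨K, hKc, hKf⟩ := mem_cocompact.1
        ((Metric.tendsto_nhds.1 (zero_at_infty f)) ε hε)
      filter_upwards [hK K hKc] with ω hω
      by_cases h : ∃ b : A, r ω b ≠ 0
      · have e : F ω = f (ofHom (r ω) h) := dif_pos h
        rw [e]
        exact hKf fun hmem => hω _ hmem fun b => rfl
      · have e : F ω = 0 := dif_neg h
        rw [e, dist_self]
        exact hε
  obtain ⟨x, hx⟩ := (gelfandTransform_bijective A₁).2 ⟨F, hF⟩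
  have hx' (ω : characterSpace ℂ A₁) : ω x = F ω := DFunLike.congr_fun hx ω
  -- The point at infinity is the character of the unitization that kills `A`
  have hx0 : x.fst = 0 := by
    let ω := equivAlgHom.symm (Unitization.fstHom ℂ A)
    have h1 : ω x = x.fst := rfl
    rw [← h1, hx']
    exact dif_neg fun ⟨b, hb⟩ => hb rfl
  refine ⟨x.snd, fun χ => ?_⟩
  let ω := equivAlgHom.symm (Unitization.lift (toNonUnitalAlgHom χ))
  have hr : ∀ b, r ω b = χ b := fun b => by
    change Unitization.lift (toNonUnitalAlgHom χ) (b : A₁) = _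
    simp
  have hω : ∃ b : A, r ω b ≠ 0 := by
    obtain ⟨b, hb⟩ := exists_apply_ne_zero χ
    exact ⟨b, by rwa [hr]⟩
  have e : ofHom (r ω) hω = χ := ext fun b => hr b
  have h1 := hx' ω
  rw [show F ω = f (ofHom (r ω) hω) from dif_pos hω, e] at h1
  rw [← h1, ← hr]
  have hxx : ((x.snd : A) : A₁) = x := Unitization.ext hx0.symm rfl
  change ω ((x.snd : A) : A₁) = ω x
  rw [hxx]

end CommGelfand

/-- Gelfand duality for non-unital commutative C⋆-algebras. Commutativity is a mixin, because it
will be derived for C⋆-tensor products of commutative algebras. -/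
theorem gelfandZeroAtInfty_bijective [IsMulCommutative A] :
    Function.Bijective (gelfandZeroAtInfty A) := by
  let _ : NonUnitalCommCStarAlgebra A :=
    { ‹NonUnitalCStarAlgebra A› with mul_comm := IsMulCommutative.is_comm.comm }
  refine ⟨(injective_iff_map_eq_zero _).2 fun a ha => ?_, fun f => ?_⟩
  · exact eq_zero_of_forall_character fun χ => DFunLike.congr_fun ha χ
  · obtain ⟨a, ha⟩ := exists_forall_character_eq f
    exact ⟨a, DFunLike.ext _ _ ha⟩

theorem eq_of_forall_character [IsMulCommutative A] {a b : A}
    (h : ∀ χ : characterSpace ℂ A, χ a = χ b) : a = b :=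
  gelfandZeroAtInfty_bijective.1 (DFunLike.ext _ _ h)

theorem exists_character_ne_zero_of_isOpen [IsMulCommutative A] {U : Set (characterSpace ℂ A)}
    (hU : IsOpen U) {χ : characterSpace ℂ A} (hχ : χ ∈ U) :
    ∃ a : A, χ a ≠ 0 ∧ ∀ ω ∉ U, ω a = 0 := by
  obtain ⟨f, hf1, hf0, hfc, -⟩ := exists_continuous_one_zero_of_isCompact
    (isCompact_singleton (x := χ)) hU.isClosed_compl (by simpa using hχ)
  have hfc' : HasCompactSupport fun ω => (f ω : ℂ) :=
    hfc.comp_left (g := ((↑) : ℝ → ℂ)) Complex.ofReal_zero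
  obtain ⟨a, ha⟩ := gelfandZeroAtInfty_bijective.2
    (⟨⟨fun ω => (f ω : ℂ), by fun_prop⟩, hfc'.is_zero_at_infty⟩ : C₀(characterSpace ℂ A, ℂ))
  have ha' (ω : characterSpace ℂ A) : ω a = f ω := DFunLike.congr_fun ha ω
  refine ⟨a, ?_, fun ω hω => ?_⟩
  · rw [ha', hf1 rfl]; simp
  · rw [ha', hf0 hω]; simp

end Gelfand

/-! ### Proper maps into products of character spaces -/

section Proper

/-- A continuous map is proper as soon as its target carries enough continuous functions whose
pull-backs vanish at infinity. -/
theorem isProperMap_of_tendsto_cocompact {X Y : Type*} [TopologicalSpace X] [TopologicalSpace Y]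
    [T2Space Y] [LocallyCompactSpace Y] {f : X → Y} (hf : Continuous f)
    (h : ∀ y, ∃ g : Y → ℂ, Continuous g ∧ g y ≠ 0 ∧
      Tendsto (fun x => g (f x)) (cocompact X) (𝓝 0)) : IsProperMap f := by
  refine isProperMap_iff_isCompact_preimage.2 ⟨hf, fun K hK => ?_⟩
  suffices h' : ∃ C : Set X, IsCompact C ∧ f ⁻¹' K ⊆ C by
    obtain ⟨C, hC, hKC⟩ := h'
    exact hC.of_isClosed_subset (hK.isClosed.preimage hf) hKC
  refine hK.induction_on (p := fun K => ∃ C : Set X, IsCompact C ∧ f ⁻¹' K ⊆ C)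
    ⟨∅, isCompact_empty, by simp⟩ (fun s t hst ⟨C, hC, h⟩ =>
      ⟨C, hC, (Set.preimage_mono hst).trans h⟩) (fun s t ⟨C, hC, h⟩ ⟨D, hD, h'⟩ =>
      ⟨C ∪ D, hC.union hD, Set.union_subset_union h h'⟩) fun y _ => ?_
  obtain ⟨g, hg, hgy, hlim⟩ := h y
  have hgy' : 0 < ‖g y‖ := norm_pos_iff.2 hgy
  obtain ⟨C, hC, hCg⟩ := mem_cocompact.1 ((Metric.tendsto_nhds.1 hlim) _ (half_pos hgy'))
  refine ⟨{z | ‖g y‖ / 2 < ‖g z‖}, mem_nhdsWithin_of_mem_nhds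
    (hg.norm.continuousAt.eventually_const_lt (half_lt_self hgy')), C, hC, fun x hx => ?_⟩
  by_contra hxC
  have h1 : dist (g (f x)) 0 < ‖g y‖ / 2 := hCg hxC
  rw [dist_zero_right] at h1
  exact lt_asymm hx h1

variable {A : Type*} [NonUnitalCStarAlgebra A] {B : Type*} [NonUnitalCStarAlgebra B]
  {X : Type*} [TopologicalSpace X]

theorem isProperMap_prod_characters {f : X → characterSpace ℂ A × characterSpace ℂ B}
    (hf : Continuous f)
    (h : ∀ (a : A) (b : B), Tendsto (fun x => (f x).1 a * (f x).2 b) (cocompact X) (𝓝 0)) :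
    IsProperMap f := by
  refine isProperMap_of_tendsto_cocompact hf fun ⟨p, q⟩ => ?_
  obtain ⟨a, ha⟩ := exists_apply_ne_zero p
  obtain ⟨b, hb⟩ := exists_apply_ne_zero q
  exact ⟨fun y => y.1 a * y.2 b, ((continuous_eval_apply a).comp continuous_fst).mul
    ((continuous_eval_apply b).comp continuous_snd), mul_ne_zero ha hb, h a b⟩

/-- A proper map has closed range, and a missed open box `U × V` would carry elementary tensors
`a ⊗ b ≠ 0` that vanish along `f`. -/
theorem surjective_prod_characters [IsMulCommutative A] [IsMulCommutative B]
    {f : X → characterSpace ℂ A × characterSpace ℂ B} (hf : IsProperMap f)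
    (h : ∀ (a : A) (b : B), (∀ x, (f x).1 a * (f x).2 b = 0) → a = 0 ∨ b = 0) :
    Function.Surjective f := by
  intro y
  by_contra hy
  have hmem : (Set.range f)ᶜ ∈ 𝓝 y := hf.isClosedMap.isClosed_range.isOpen_compl.mem_nhds hy
  obtain ⟨U, V, hU, hyU, hV, hyV, hUV⟩ := mem_nhds_prod_iff'.1 hmem
  obtain ⟨a, ha, haU⟩ := exists_character_ne_zero_of_isOpen hU hyU
  obtain ⟨b, hb, hbV⟩ := exists_character_ne_zero_of_isOpen hV hyV
  have hab (x : X) : (f x).1 a * (f x).2 b = 0 := by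
    by_cases h1 : (f x).1 ∈ U
    · have h2 : (f x).2 ∉ V := fun h2 => hUV (Set.mk_mem_prod h1 h2) ⟨x, rfl⟩
      rw [hbV _ h2, mul_zero]
    · rw [haU _ h1, zero_mul]
  rcases h a b hab with rfl | rfl
  · exact ha (map_zero _)
  · exact hb (map_zero _)

theorem exists_character_ne_zero [IsMulCommutative A] {a : A} (ha : a ≠ 0) :
    ∃ χ : characterSpace ℂ A, χ a ≠ 0 := by
  by_contra! h
  exact ha (eq_of_forall_character fun χ => (h χ).trans (map_zero χ).symm)

theorem eq_zero_or_eq_zero_of_tmul_eq_zero [IsMulCommutative A] [IsMulCommutative B] {a : A} {b : B}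
    (h : a ⊗ₜ[ℂ] b = 0) : a = 0 ∨ b = 0 := by
  by_contra! hab
  obtain ⟨p, hp⟩ := exists_character_ne_zero hab.1
  obtain ⟨q, hq⟩ := exists_character_ne_zero hab.2
  have := congrArg (LinearMap.mul' ℂ ℂ ∘ₗ
    TensorProduct.map (toCLM p : A →ₗ[ℂ] ℂ) (toCLM q : B →ₗ[ℂ] ℂ)) h
  simp [hp, hq] at this

end Proper

/-! ### Characters and multipliers -/

section Multiplier

variable {T : Type*} [NonUnitalCStarAlgebra T]

namespace WeakDual.CharacterSpace

theorem apply_mul_apply_fst (χ : characterSpace ℂ T) (m : 𝓜(ℂ, T)) (x y : T) :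
    χ x * χ (m.fst y) = χ (m.snd x) * χ y := by
  rw [← map_mul, ← map_mul, m.central]

/-- The ratio `χ (m x) / χ x` does not depend on `x`. -/
theorem apply_fst_mul_apply (χ : characterSpace ℂ T) (m : 𝓜(ℂ, T)) (x y : T) :
    χ (m.fst x) * χ y = χ x * χ (m.fst y) := by
  obtain ⟨e, he⟩ := exists_apply_ne_zero χ
  refine mul_left_cancel₀ he ?_
  linear_combination χ y * apply_mul_apply_fst χ m e x - χ x * apply_mul_apply_fst χ m e y

/-- The extension of a character `χ` of `T` to the multiplier algebra, determined by
`χ (m x) = χ m * χ x`. -/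
noncomputable def extend (χ : characterSpace ℂ T) : 𝓜(ℂ, T) →ₙₐ[ℂ] ℂ :=
  let e := (exists_apply_ne_zero χ).choose
  have he : χ e ≠ 0 := (exists_apply_ne_zero χ).choose_spec
  { toFun m := χ (m.fst e) / χ e
    map_smul' c m := by simp [mul_div_assoc]
    map_zero' := by simp
    map_add' m n := by simp [add_div]
    map_mul' m n := by
      have h := apply_fst_mul_apply χ m (n.fst e) e
      change χ (m.fst (n.fst e)) / χ e = _
      field_simp
      linear_combination h }

theorem apply_fst (χ : characterSpace ℂ T) (m : 𝓜(ℂ, T)) (x : T) :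
    χ (m.fst x) = extend χ m * χ x := by
  set e := (exists_apply_ne_zero χ).choose with he
  have he0 : χ e ≠ 0 := (exists_apply_ne_zero χ).choose_spec
  have h : extend χ m = χ (m.fst e) / χ e := rfl
  have := apply_fst_mul_apply χ m x e
  rw [h]
  field_simp
  linear_combination this

theorem apply_snd (χ : characterSpace ℂ T) (m : 𝓜(ℂ, T)) (x : T) :
    χ (m.snd x) = extend χ m * χ x := by
  obtain ⟨e, he⟩ := exists_apply_ne_zero χ
  refine mul_right_cancel₀ he ?_
  rw [← apply_mul_apply_fst, apply_fst]
  ring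

theorem extend_eq_div (χ : characterSpace ℂ T) (m : 𝓜(ℂ, T)) {x : T} (hx : χ x ≠ 0) :
    extend χ m = χ (m.fst x) / χ x := by
  rw [apply_fst, mul_div_cancel_right₀ _ hx]

theorem extend_eq_of_forall {χ : characterSpace ℂ T} {m : 𝓜(ℂ, T)} {c : ℂ}
    (h : ∀ x, χ (m.fst x) = c * χ x) : extend χ m = c := by
  obtain ⟨e, he⟩ := exists_apply_ne_zero χ
  rw [extend_eq_div χ m he, h, mul_div_cancel_right₀ _ he]

@[simp] theorem extend_coe (χ : characterSpace ℂ T) (x : T) : extend χ (x : 𝓜(ℂ, T)) = χ x :=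
  extend_eq_of_forall fun y => map_mul χ x y

@[simp] theorem extend_one (χ : characterSpace ℂ T) : extend χ (1 : 𝓜(ℂ, T)) = 1 :=
  extend_eq_of_forall fun _ => (one_mul _).symm

theorem extend_star (χ : characterSpace ℂ T) (m : 𝓜(ℂ, T)) :
    extend χ (star m) = star (extend χ m) :=
  (extend χ).map_star_complex m

theorem continuous_extend (m : 𝓜(ℂ, T)) :
    Continuous fun χ : characterSpace ℂ T => extend χ m := by
  refine continuous_iff_continuousAt.2 fun χ => ?_
  obtain ⟨e, he⟩ := exists_apply_ne_zero χ
  refine ((continuous_eval_apply (m.fst e)).continuousAt.div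
    (continuous_eval_apply e).continuousAt he).congr ?_
  filter_upwards [(continuous_eval_apply e).continuousAt.eventually_ne he] with ω hω
  exact (extend_eq_div ω m hω).symm

end WeakDual.CharacterSpace

theorem DoubleCentralizer.eq_of_forall_extend [IsMulCommutative T] {m n : 𝓜(ℂ, T)}
    (h : ∀ χ : characterSpace ℂ T, extend χ m = extend χ n) : m = n := by
  refine DoubleCentralizer.ext _ _ _ _ (Prod.ext ?_ ?_)
  · ext x
    exact eq_of_forall_character fun χ => by rw [apply_fst, apply_fst, h]
  · ext x
    exact eq_of_forall_character fun χ => by rw [apply_snd, apply_snd, h]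

/-- A bounded continuous function on the character space acts on a commutative C⋆-algebra as a
multiplier. -/
theorem exists_multiplier [IsMulCommutative T] {h : characterSpace ℂ T → ℂ} (hc : Continuous h)
    {C : ℝ} (hC : ∀ χ, ‖h χ‖ ≤ C) : ∃ m : 𝓜(ℂ, T), ∀ χ, extend χ m = h χ := by
  have key (x : T) : ∃ y : T, ∀ χ : characterSpace ℂ T, χ y = h χ * χ x := by
    have h0 : Tendsto (fun χ : characterSpace ℂ T => h χ * χ x) (cocompact _) (𝓝 0) :=
      isBoundedUnder_le_mul_tendsto_zero (isBoundedUnder_of ⟨C, hC⟩) (tendsto_apply_cocompact x)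
    obtain ⟨y, hy⟩ := gelfandZeroAtInfty_bijective.2
      (⟨⟨fun χ => h χ * χ x, by fun_prop⟩, h0⟩ : C₀(characterSpace ℂ T, ℂ))
    exact ⟨y, fun χ => DFunLike.congr_fun hy χ⟩
  choose L hL using key
  let Lₗ : T →ₗ[ℂ] T :=
    { toFun := L
      map_add' x y := eq_of_forall_character fun χ => by simp only [hL, map_add, mul_add]
      map_smul' c x := eq_of_forall_character fun χ => by
        simp only [hL, map_smul, RingHom.id_apply, smul_eq_mul, mul_left_comm] }
  have hgraph : IsClosed (Lₗ.graph : Set (T × T)) := by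
    have e : (Lₗ.graph : Set (T × T))
        = ⋂ χ : characterSpace ℂ T, {z | χ z.2 = h χ * χ z.1} := by
      ext z
      simp only [SetLike.mem_coe, LinearMap.mem_graph_iff, Set.mem_iInter, Set.mem_ofPred_eq]
      refine ⟨fun hz χ => hz ▸ hL _ χ, fun hz => eq_of_forall_character fun χ => ?_⟩
      rw [hz]
      exact (hL _ χ).symm
    rw [e]
    refine isClosed_iInter fun χ => isClosed_eq ?_ ?_
    · exact (map_continuous χ).comp continuous_snd
    · exact continuous_const.mul ((map_continuous χ).comp continuous_fst)
  let Lc : T →L[ℂ] T := ⟨Lₗ, Lₗ.continuous_of_isClosed_graph hgraph⟩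
  refine ⟨⟨(Lc, Lc), fun x y => eq_of_forall_character fun χ => ?_⟩, fun χ =>
    extend_eq_of_forall fun x => hL x χ⟩
  change χ (L x * y) = χ (x * L y)
  rw [map_mul, map_mul, hL, hL]
  ring

section Pullback

variable {S : Type*} [NonUnitalCStarAlgebra S] [IsMulCommutative S]

/-- A continuous map `π` between character spaces induces a ⋆-homomorphism between multiplier
algebras, the pull-back of bounded continuous functions along `π`. -/
theorem exists_pullback_multiplier {π : characterSpace ℂ S → characterSpace ℂ T}
    (hπ : Continuous π) : ∃ Φ : 𝓜(ℂ, T) →⋆ₙₐ[ℂ] 𝓜(ℂ, S),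
      ∀ m χ, extend χ (Φ m) = extend (π χ) m := by
  have key (m : 𝓜(ℂ, T)) : ∃ n : 𝓜(ℂ, S), ∀ χ, extend χ n = extend (π χ) m :=
    exists_multiplier ((continuous_extend m).comp hπ) fun χ =>
      (extend (π χ)).norm_apply_le_norm m
  choose F hF using key
  exact ⟨
    { toFun := F
      map_smul' c m := DoubleCentralizer.eq_of_forall_extend fun χ => by simp [hF]
      map_zero' := DoubleCentralizer.eq_of_forall_extend fun χ => by simp [hF]
      map_add' m n := DoubleCentralizer.eq_of_forall_extend fun χ => by simp [hF]
      map_mul' m n := DoubleCentralizer.eq_of_forall_extend fun χ => by simp [hF]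
      map_star' m := DoubleCentralizer.eq_of_forall_extend fun χ => by simp [hF, extend_star] },
    hF⟩

end Pullback

end Multiplier

/-! ### The character space of a C⋆-tensor product -/

section TensorCharacters

variable {A B T : Type*} [NonUnitalCStarAlgebra A] [NonUnitalCStarAlgebra B]
  [NonUnitalCStarAlgebra T]

namespace CStarTensor

theorem apply_incl_mul_apply_incl (t : CStarTensor A B T) (χ : characterSpace ℂ T) (a a' : A)
    (b b' : B) :
    χ (t.incl (a ⊗ₜ b)) * χ (t.incl (a' ⊗ₜ b')) = χ (t.incl ((a * a') ⊗ₜ (b * b'))) := by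
  rw [← map_mul, ← map_mul, Algebra.TensorProduct.tmul_mul_tmul]

theorem clm_ext (t : CStarTensor A B T) {f g : T →L[ℂ] ℂ}
    (h : ∀ a b, f (t.incl (a ⊗ₜ b)) = g (t.incl (a ⊗ₜ b))) : f = g := by
  refine DFunLike.coe_injective (t.dense.equalizer f.continuous g.continuous (funext fun x => ?_))
  induction x with
  | zero => simp
  | add x y hx hy =>
    simp only [Function.comp_apply] at hx hy ⊢
    rw [map_add, map_add, map_add, hx, hy]
  | tmul a b => exact h a b

theorem character_ext (t : CStarTensor A B T) {χ ω : characterSpace ℂ T}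
    (h : ∀ a b, χ (t.incl (a ⊗ₜ b)) = ω (t.incl (a ⊗ₜ b))) : χ = ω :=
  CharacterSpace.ext fun x => DFunLike.congr_fun (t.clm_ext (f := toCLM χ) (g := toCLM ω) h) x

theorem exists_character_incl_ne_zero (t : CStarTensor A B T) (χ : characterSpace ℂ T) :
    ∃ a b, χ (t.incl (a ⊗ₜ b)) ≠ 0 := by
  by_contra! h
  obtain ⟨x, hx⟩ := exists_apply_ne_zero χ
  exact hx (DFunLike.congr_fun (t.clm_ext (f := toCLM χ) (g := 0) h) x)

variable [IsMulCommutative A] [IsMulCommutative B]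

theorem isMulCommutative (t : CStarTensor A B T) : IsMulCommutative T := by
  have halg (x y : A ⊗[ℂ] B) : x * y = y * x := by
    induction x with
    | zero => simp
    | add x₁ x₂ h₁ h₂ => rw [add_mul, mul_add, h₁, h₂]
    | tmul a b =>
      induction y with
      | zero => simp
      | add y₁ y₂ h₁ h₂ => rw [add_mul, mul_add, h₁, h₂]
      | tmul c d =>
        rw [Algebra.TensorProduct.tmul_mul_tmul, Algebra.TensorProduct.tmul_mul_tmul,
          IsMulCommutative.is_comm.comm a c, IsMulCommutative.is_comm.comm b d]
  refine ⟨⟨fun x y => t.dense.induction_on₂ (p := fun x y => x * y = y * x)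
    (isClosed_eq (by fun_prop) (by fun_prop)) (fun a b => ?_) x y⟩⟩
  rw [← map_mul, ← map_mul, halg]

/-- Every character of a C⋆-tensor product of commutative C⋆-algebras is a product of characters
of the factors. -/
theorem exists_character_factors (t : CStarTensor A B T) (χ : characterSpace ℂ T) :
    ∃ (p : characterSpace ℂ A) (q : characterSpace ℂ B),
      ∀ a b, χ (t.incl (a ⊗ₜ b)) = p a * q b := by
  obtain ⟨a₀, b₀, h₀⟩ := t.exists_character_incl_ne_zero χ
  set c := χ (t.incl (a₀ ⊗ₜ b₀)) with hc
  let f : A →ₙₐ[ℂ] ℂ :=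
    { toFun a := χ (t.incl ((a * a₀) ⊗ₜ b₀)) / c
      map_smul' r a := by
        rw [smul_mul_assoc, ← TensorProduct.smul_tmul', map_smul, map_smul, smul_eq_mul,
          mul_div_assoc]
        rfl
      map_zero' := by simp
      map_add' a a' := by simp [add_mul, TensorProduct.add_tmul, add_div]
      map_mul' a a' := by
        have h : χ (t.incl ((a * a' * a₀) ⊗ₜ b₀)) * c
            = χ (t.incl ((a * a₀) ⊗ₜ b₀)) * χ (t.incl ((a' * a₀) ⊗ₜ b₀)) := by
          rw [hc, apply_incl_mul_apply_incl, apply_incl_mul_apply_incl]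
          have e : a * a' * a₀ * a₀ = a * a₀ * (a' * a₀) := by
            rw [mul_assoc a a' a₀, mul_assoc, mul_assoc a a₀,
              IsMulCommutative.is_comm.comm (a' * a₀) a₀]
          rw [e]
        field_simp
        exact h }
  let g : B →ₙₐ[ℂ] ℂ :=
    { toFun b := χ (t.incl (a₀ ⊗ₜ (b * b₀))) / c
      map_smul' r b := by
        simp [smul_mul_assoc, mul_div_assoc]
      map_zero' := by simp
      map_add' b b' := by simp [add_mul, TensorProduct.tmul_add, add_div]
      map_mul' b b' := by
        have h : χ (t.incl (a₀ ⊗ₜ (b * b' * b₀))) * c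
            = χ (t.incl (a₀ ⊗ₜ (b * b₀))) * χ (t.incl (a₀ ⊗ₜ (b' * b₀))) := by
          rw [hc, apply_incl_mul_apply_incl, apply_incl_mul_apply_incl]
          have e : b * b' * b₀ * b₀ = b * b₀ * (b' * b₀) := by
            rw [mul_assoc b b' b₀, mul_assoc, mul_assoc b b₀,
              IsMulCommutative.is_comm.comm (b' * b₀) b₀]
          rw [e]
        field_simp
        exact h }
  have hfg (a : A) (b : B) : χ (t.incl (a ⊗ₜ b)) = f a * g b := by
    have h : χ (t.incl (a ⊗ₜ b)) * (c * c)
        = χ (t.incl ((a * a₀) ⊗ₜ b₀)) * χ (t.incl (a₀ ⊗ₜ (b * b₀))) := by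
      simp only [hc, apply_incl_mul_apply_incl]
      congr 3
      · rw [mul_assoc]
      · rw [← mul_assoc]
        exact IsMulCommutative.is_comm.comm (b * b₀) b₀
    change _ = χ (t.incl ((a * a₀) ⊗ₜ b₀)) / c * (χ (t.incl (a₀ ⊗ₜ (b * b₀))) / c)
    field_simp
    linear_combination h
  have h0 : f a₀ * g b₀ ≠ 0 := hfg a₀ b₀ ▸ h₀
  exact ⟨ofHom f ⟨a₀, left_ne_zero_of_mul h0⟩, ofHom g ⟨b₀, right_ne_zero_of_mul h0⟩, hfg⟩

/-- The two characters of which a character of a C⋆-tensor product is the product. -/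
noncomputable def factors (t : CStarTensor A B T) (χ : characterSpace ℂ T) :
    characterSpace ℂ A × characterSpace ℂ B :=
  ((t.exists_character_factors χ).choose, (t.exists_character_factors χ).choose_spec.choose)

theorem apply_incl (t : CStarTensor A B T) (χ : characterSpace ℂ T) (a : A) (b : B) :
    χ (t.incl (a ⊗ₜ b)) = (t.factors χ).1 a * (t.factors χ).2 b :=
  (t.exists_character_factors χ).choose_spec.choose_spec a b

theorem continuous_factors (t : CStarTensor A B T) : Continuous t.factors := by
  refine Continuous.prodMk (continuous_of_apply fun a => continuous_iff_continuousAt.2 fun χ => ?_)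
    (continuous_of_apply fun b => continuous_iff_continuousAt.2 fun χ => ?_)
  all_goals obtain ⟨a₀, b₀, h₀⟩ := t.exists_character_incl_ne_zero χ
  · refine ((continuous_eval_apply (t.incl ((a * a₀) ⊗ₜ b₀))).continuousAt.div
      (continuous_eval_apply (t.incl (a₀ ⊗ₜ b₀))).continuousAt h₀).congr ?_
    filter_upwards [(continuous_eval_apply (t.incl (a₀ ⊗ₜ b₀))).continuousAt.eventually_ne h₀]
      with ω hω
    change ω (t.incl ((a * a₀) ⊗ₜ b₀)) / ω (t.incl (a₀ ⊗ₜ b₀)) = (t.factors ω).1 a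
    rw [div_eq_iff hω, apply_incl, apply_incl, map_mul, mul_assoc]
  · refine ((continuous_eval_apply (t.incl (a₀ ⊗ₜ (b * b₀)))).continuousAt.div
      (continuous_eval_apply (t.incl (a₀ ⊗ₜ b₀))).continuousAt h₀).congr ?_
    filter_upwards [(continuous_eval_apply (t.incl (a₀ ⊗ₜ b₀))).continuousAt.eventually_ne h₀]
      with ω hω
    change ω (t.incl (a₀ ⊗ₜ (b * b₀))) / ω (t.incl (a₀ ⊗ₜ b₀)) = (t.factors ω).2 b
    rw [div_eq_iff hω, apply_incl, apply_incl, map_mul]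
    ring

theorem factors_injective (t : CStarTensor A B T) : Function.Injective t.factors :=
  fun χ ω h => t.character_ext fun a b => by rw [apply_incl, apply_incl, h]

theorem isProperMap_factors (t : CStarTensor A B T) : IsProperMap t.factors :=
  isProperMap_prod_characters t.continuous_factors fun a b => by
    simpa only [apply_incl] using tendsto_apply_cocompact (t.incl (a ⊗ₜ b))

theorem factors_surjective (t : CStarTensor A B T) : Function.Surjective t.factors :=
  surjective_prod_characters t.isProperMap_factors fun a b h => by
    have := t.isMulCommutative
    have h0 : t.incl (a ⊗ₜ b) = 0 := eq_of_forall_character fun χ => by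
      rw [apply_incl, h, map_zero]
    exact eq_zero_or_eq_zero_of_tmul_eq_zero (t.injective (h0.trans (map_zero t.incl).symm))

/-- The character space of a C⋆-tensor product of commutative C⋆-algebras is the product of the
character spaces of the factors, whatever the C⋆-norm. -/
noncomputable def charHomeo (t : CStarTensor A B T) :
    characterSpace ℂ T ≃ₜ characterSpace ℂ A × characterSpace ℂ B :=
  (Equiv.ofBijective t.factors ⟨t.factors_injective, t.factors_surjective⟩)
    |>.toHomeomorphOfContinuousClosed t.continuous_factors t.isProperMap_factors.isClosedMap

/-- The product character `p ⊗ q`. -/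
noncomputable def prodChar (t : CStarTensor A B T) (p : characterSpace ℂ A)
    (q : characterSpace ℂ B) : characterSpace ℂ T :=
  t.charHomeo.symm (p, q)

theorem factors_prodChar (t : CStarTensor A B T) (p : characterSpace ℂ A)
    (q : characterSpace ℂ B) : t.factors (t.prodChar p q) = (p, q) :=
  t.charHomeo.apply_symm_apply (p, q)

theorem prodChar_factors (t : CStarTensor A B T) (χ : characterSpace ℂ T) :
    t.prodChar (t.factors χ).1 (t.factors χ).2 = χ :=
  t.charHomeo.symm_apply_apply χ

theorem prodChar_apply_incl (t : CStarTensor A B T) (p : characterSpace ℂ A)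
    (q : characterSpace ℂ B) (a : A) (b : B) : t.prodChar p q (t.incl (a ⊗ₜ b)) = p a * q b := by
  rw [apply_incl, factors_prodChar]

theorem continuous_prodChar (t : CStarTensor A B T) :
    Continuous fun z : characterSpace ℂ A × characterSpace ℂ B => t.prodChar z.1 z.2 :=
  t.charHomeo.symm.continuous

theorem extend_mult (t : CStarTensor A B T) (χ : characterSpace ℂ T) (m : 𝓜(ℂ, A)) (n : 𝓜(ℂ, B)) :
    extend χ (t.mult m n) = extend (t.factors χ).1 m * extend (t.factors χ).2 n := by
  obtain ⟨a, b, h⟩ := t.exists_character_incl_ne_zero χ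
  rw [extend_eq_div χ _ h, mult_fst_incl, div_eq_iff h, apply_incl, apply_incl, apply_fst, apply_fst]
  ring

end CStarTensor

end TensorCharacters

/-! ### Semigroups whose shear map is proper -/

section Shear

/-- A non-empty semigroup with a topology is a topological group if its shear map
`(p, q) ↦ (p q, q)` is proper and both shear maps are surjective. -/
theorem exists_group_of_shear {G : Type*} [TopologicalSpace G] [Nonempty G] (m : G → G → G)
    (assoc : ∀ p q r, m (m p q) r = m p (m q r))
    (hproper : IsProperMap fun z : G × G => (m z.1 z.2, z.2))
    (hright : Function.Surjective fun z : G × G => (m z.1 z.2, z.2))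
    (hleft : Function.Surjective fun z : G × G => (m z.1 z.2, z.1)) :
    ∃ _ : Group G, IsTopologicalGroup G ∧ ∀ p q : G, p * q = m p q := by
  have hdivr (a b : G) : ∃ x, m x a = b := by
    obtain ⟨⟨x, y⟩, h⟩ := hright (b, a)
    obtain ⟨h1, rfl⟩ := Prod.mk.inj h
    exact ⟨x, h1⟩
  have hdivl (a b : G) : ∃ y, m a y = b := by
    obtain ⟨⟨x, y⟩, h⟩ := hleft (b, a)
    obtain ⟨h1, rfl⟩ := Prod.mk.inj h
    exact ⟨y, h1⟩
  obtain ⟨g⟩ := ‹Nonempty G›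
  -- `e` is a left unit for `g`, hence for every `g * y`, and these exhaust `G`.
  obtain ⟨e, he⟩ := hdivr g g
  have one_mul' (a : G) : m e a = a := by
    obtain ⟨y, rfl⟩ := hdivl g a
    rw [← assoc, he]
  choose inv hinv using fun a => hdivr a e
  let _ : Mul G := ⟨m⟩
  let _ : One G := ⟨e⟩
  let _ : Inv G := ⟨inv⟩
  let grp : Group G := Group.ofLeftAxioms assoc one_mul' hinv
  have hinj : Function.Injective fun z : G × G => (m z.1 z.2, z.2) := by
    rintro ⟨p, q⟩ ⟨p', q'⟩ h
    obtain ⟨h1, rfl⟩ := Prod.mk.inj h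
    have h1 : p * q = p' * q := h1
    rw [mul_right_cancel h1]
  let E : G × G ≃ₜ G × G := (Equiv.ofBijective _ ⟨hinj, hright⟩).toHomeomorphOfContinuousClosed
    hproper.continuous hproper.isClosedMap
  have hE (q : G) : E.symm (1, q) = (q⁻¹, q) := by
    rw [Homeomorph.symm_apply_eq]
    exact Prod.ext (inv_mul_cancel q).symm rfl
  refine ⟨grp, { continuous_mul := hproper.continuous.fst, continuous_inv := ?_ }, fun _ _ => rfl⟩
  have h : Continuous fun q : G => (E.symm (1, q)).1 := by fun_prop
  simpa only [hE] using h

end Shear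

/-! ### The semigroup of characters of a comultiplication -/

section Convolution

variable {A : Type u} {T : Type v} {S : Type w} [NonUnitalCommCStarAlgebra A]
    [NonUnitalCStarAlgebra T] [NonUnitalCStarAlgebra S]

theorem IsNondegenerateComult.exists_extend_ne_zero {t : CStarTensor A A T}
    {Δ : A →⋆ₙₐ[ℂ] 𝓜(ℂ, T)} (h : IsNondegenerateComult t Δ) (χ : characterSpace ℂ T) :
    ∃ a, extend χ (Δ a) ≠ 0 := by
  by_contra! h0
  obtain ⟨x, hx⟩ := exists_apply_ne_zero χ
  refine hx (DFunLike.congr_fun (f := toCLM χ) (g := 0) (ContinuousLinearMap.ext_on h ?_) x)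
  rintro _ ⟨a, b, c, rfl⟩
  simp [apply_fst, h0]

/-- The character `χ ∘ Δ` of `A`, for a character `χ` of `A ⊗̄ A`. -/
noncomputable def IsNondegenerateComult.compChar {t : CStarTensor A A T}
    {Δ : A →⋆ₙₐ[ℂ] 𝓜(ℂ, T)} (h : IsNondegenerateComult t Δ) (χ : characterSpace ℂ T) :
    characterSpace ℂ A :=
  ofHom ((extend χ).comp (Δ : A →ₙₐ[ℂ] 𝓜(ℂ, T))) (h.exists_extend_ne_zero χ)

namespace IsNondegenerateComult

variable {t : CStarTensor A A T} {Δ : A →⋆ₙₐ[ℂ] 𝓜(ℂ, T)}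

theorem continuous_compChar (h : IsNondegenerateComult t Δ) : Continuous h.compChar :=
  continuous_of_apply fun a => continuous_extend (Δ a)

/-- The convolution product `p * q = (p ⊗ q) ∘ Δ` of characters. -/
noncomputable def conv (h : IsNondegenerateComult t Δ) (p q : characterSpace ℂ A) :
    characterSpace ℂ A :=
  h.compChar (t.prodChar p q)

theorem continuous_conv (h : IsNondegenerateComult t Δ) :
    Continuous fun z : characterSpace ℂ A × characterSpace ℂ A => h.conv z.1 z.2 :=
  h.continuous_compChar.comp t.continuous_prodChar

end IsNondegenerateComult

/-- The characters `(p ⊗ q) ⊗ r` and `p ⊗ (q ⊗ r)` of `A ⊗̄ A ⊗̄ A` agree. -/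
theorem CStarTripleTensor.left_prodChar_eq_right {t : CStarTensor A A T}
    (t₃ : CStarTripleTensor t S) (p q r : characterSpace ℂ A) :
    haveI := t.isMulCommutative
    t₃.left.prodChar (t.prodChar p q) r = t₃.right.prodChar p (t.prodChar q r) := by
  have := t.isMulCommutative
  rw [← t₃.right.prodChar_factors (t₃.left.prodChar (t.prodChar p q) r)]
  set p' := (t₃.right.factors (t₃.left.prodChar (t.prodChar p q) r)).1 with hp'
  set ω := (t₃.right.factors (t₃.left.prodChar (t.prodChar p q) r)).2 with hω
  refine t₃.right.character_ext fun a x => ?_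
  rw [t₃.right.prodChar_apply_incl, t₃.right.prodChar_apply_incl]
  refine DFunLike.congr_fun (t.clm_ext (f := p' a • toCLM ω)
    (g := p a • toCLM (t.prodChar q r)) fun b c => ?_) x
  change p' a * ω (t.incl (b ⊗ₜ c)) = p a * t.prodChar q r (t.incl (b ⊗ₜ c))
  rw [hp', hω, ← t₃.right.apply_incl, ← t₃.assoc, t₃.left.prodChar_apply_incl,
    t.prodChar_apply_incl, t.prodChar_apply_incl, mul_assoc]

/-- Coassociativity makes the convolution of characters associative. The extensions of `Δ ⊗ ι` and
`ι ⊗ Δ` to multipliers are the pull-backs along `(p, q, r) ↦ (p * q, r)` and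
`(p, q, r) ↦ (p, q * r)`. -/
theorem IsComultiplication.conv_assoc {t : CStarTensor A A T} {t₃ : CStarTripleTensor t S}
    {Δ : A →⋆ₙₐ[ℂ] 𝓜(ℂ, T)} (hΔ : IsComultiplication t t₃ Δ) (p q r : characterSpace ℂ A) :
    hΔ.nondegenerate.conv (hΔ.nondegenerate.conv p q) r
      = hΔ.nondegenerate.conv p (hΔ.nondegenerate.conv q r) := by
  have := t.isMulCommutative
  have := t₃.left.isMulCommutative
  have hD := hΔ.nondegenerate
  have hπ₁ : Continuous fun χ : characterSpace ℂ S =>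
      t.prodChar (hD.compChar (t₃.left.factors χ).1) (t₃.left.factors χ).2 :=
    t.continuous_prodChar.comp ((hD.continuous_compChar.comp t₃.left.continuous_factors.fst).prodMk
      t₃.left.continuous_factors.snd)
  have hπ₂ : Continuous fun χ : characterSpace ℂ S =>
      t.prodChar (t₃.right.factors χ).1 (hD.compChar (t₃.right.factors χ).2) :=
    t.continuous_prodChar.comp (t₃.right.continuous_factors.fst.prodMk
      (hD.continuous_compChar.comp t₃.right.continuous_factors.snd))
  obtain ⟨Φ₁, h₁⟩ := exists_pullback_multiplier hπ₁
  obtain ⟨Φ₂, h₂⟩ := exists_pullback_multiplier hπ₂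
  have hΦ₁ : ExtendsComultId t₃ Δ Φ₁ := fun a b => DoubleCentralizer.eq_of_forall_extend fun χ => by
    rw [h₁, extend_coe, t.prodChar_apply_incl, t₃.left.extend_mult, extend_coe]
    rfl
  have hΦ₂ : ExtendsIdComult t₃ Δ Φ₂ := fun a b => DoubleCentralizer.eq_of_forall_extend fun χ => by
    rw [h₂, extend_coe, t.prodChar_apply_incl, t₃.right.extend_mult, extend_coe]
    rfl
  refine CharacterSpace.ext fun a => ?_
  have h := congrArg (extend (t₃.left.prodChar (t.prodChar p q) r)) (hΔ.coassoc Φ₁ Φ₂ hΦ₁ hΦ₂ a)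
  rw [h₁, h₂, t₃.left.factors_prodChar, t₃.left_prodChar_eq_right, t₃.right.factors_prodChar] at h
  exact h

namespace IsNondegenerateComult

variable {t : CStarTensor A A T} {Δ : A →⋆ₙₐ[ℂ] 𝓜(ℂ, T)}

theorem extend_mul_mult_one (h : IsNondegenerateComult t Δ) (p q : characterSpace ℂ A) (a b : A) :
    extend (t.prodChar p q) (Δ a * t.mult 1 (b : 𝓜(ℂ, A))) = h.conv p q a * q b := by
  rw [map_mul, t.extend_mult, t.factors_prodChar, extend_one, extend_coe, one_mul]
  rfl

theorem extend_mul_one_mult (h : IsNondegenerateComult t Δ) (p q : characterSpace ℂ A) (a b : A) :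
    extend (t.prodChar p q) (Δ a * t.mult (b : 𝓜(ℂ, A)) 1) = h.conv p q a * p b := by
  rw [map_mul, t.extend_mult, t.factors_prodChar, extend_one, extend_coe, mul_one]
  rfl

/-- A multiplier of `A ⊗̄ A` that lies in `A ⊗̄ A` is, on pairs of characters, a function vanishing at
infinity. -/
theorem tendsto_extend_prodChar {m : 𝓜(ℂ, T)} (hm : ∃ x : T, m = (x : 𝓜(ℂ, T))) :
    Tendsto (fun z : characterSpace ℂ A × characterSpace ℂ A => extend (t.prodChar z.1 z.2) m)
      (cocompact _) (𝓝 0) := by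
  obtain ⟨x, rfl⟩ := hm
  simp only [extend_coe]
  exact (tendsto_apply_cocompact x).comp t.charHomeo.symm.isClosedEmbedding.tendsto_cocompact

/-- `Δ(A)(1 ⊗ A) ⊆ A ⊗̄ A` makes the shear map proper, and the injectivity condition on
`Δ(a)(1 ⊗ b)` makes its range dense. -/
theorem isProperMap_surjective_shear_right (h : IsNondegenerateComult t Δ)
    (hmem : ∀ a b : A, ∃ x : T, Δ a * t.mult 1 (b : 𝓜(ℂ, A)) = (x : 𝓜(ℂ, T)))
    (hinj : ∀ a b : A, Δ a * t.mult 1 (b : 𝓜(ℂ, A)) = 0 → a ⊗ₜ[ℂ] b = 0) :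
    IsProperMap (fun z : characterSpace ℂ A × characterSpace ℂ A => (h.conv z.1 z.2, z.2)) ∧
      Function.Surjective
        fun z : characterSpace ℂ A × characterSpace ℂ A => (h.conv z.1 z.2, z.2) := by
  have := t.isMulCommutative
  have hp := isProperMap_prod_characters (h.continuous_conv.prodMk continuous_snd) fun a b => by
    simpa only [← h.extend_mul_mult_one] using tendsto_extend_prodChar (hmem a b)
  refine ⟨hp, surjective_prod_characters hp fun a b h0 => eq_zero_or_eq_zero_of_tmul_eq_zero
    (hinj a b (DoubleCentralizer.eq_of_forall_extend fun χ => ?_))⟩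
  rw [← t.prodChar_factors χ, h.extend_mul_mult_one, map_zero]
  exact h0 (t.factors χ)

/-- The mirror image of `isProperMap_surjective_shear_right`. -/
theorem isProperMap_surjective_shear_left (h : IsNondegenerateComult t Δ)
    (hmem : ∀ a b : A, ∃ x : T, Δ a * t.mult (b : 𝓜(ℂ, A)) 1 = (x : 𝓜(ℂ, T)))
    (hinj : ∀ a b : A, Δ a * t.mult (b : 𝓜(ℂ, A)) 1 = 0 → a ⊗ₜ[ℂ] b = 0) :
    IsProperMap (fun z : characterSpace ℂ A × characterSpace ℂ A => (h.conv z.1 z.2, z.1)) ∧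
      Function.Surjective
        fun z : characterSpace ℂ A × characterSpace ℂ A => (h.conv z.1 z.2, z.1) := by
  have := t.isMulCommutative
  have hp := isProperMap_prod_characters (h.continuous_conv.prodMk continuous_fst) fun a b => by
    simpa only [← h.extend_mul_one_mult] using tendsto_extend_prodChar (hmem a b)
  refine ⟨hp, surjective_prod_characters hp fun a b h0 => eq_zero_or_eq_zero_of_tmul_eq_zero
    (hinj a b (DoubleCentralizer.eq_of_forall_extend fun χ => ?_))⟩
  rw [← t.prodChar_factors χ, h.extend_mul_one_mult, map_zero]
  exact h0 (t.factors χ)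

end IsNondegenerateComult

/-- The identification of `A ⊗̄ A` with `C₀(Â × Â)`, the Gelfand transform of `A ⊗̄ A` seen on pairs
of characters. -/
theorem CStarTensor.exists_starAlgEquiv (t : CStarTensor A A T) :
    ∃ ψ : T ≃⋆ₐ[ℂ] C₀(characterSpace ℂ A × characterSpace ℂ A, ℂ),
      ∀ x p q, ψ x (p, q) = t.prodChar p q x := by
  have := t.isMulCommutative
  let e := t.charHomeo.symm
  let f : T →⋆ₙₐ[ℂ] C₀(characterSpace ℂ A × characterSpace ℂ A, ℂ) :=
    { toFun x :=
        { toFun z := e z x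
          continuous_toFun := (continuous_eval_apply x).comp e.continuous
          zero_at_infty' := (tendsto_apply_cocompact x).comp
            e.isClosedEmbedding.tendsto_cocompact }
      map_smul' c x := by ext z; exact map_smul (e z) c x
      map_zero' := by ext z; exact map_zero (e z)
      map_add' x y := by ext z; exact map_add (e z) x y
      map_mul' x y := by ext z; exact map_mul (e z) x y
      map_star' x := by ext z; exact apply_star (e z) x }
  refine ⟨StarAlgEquiv.ofBijective f ⟨(injective_iff_map_eq_zero f).2 fun x hx => ?_,
    fun g => ?_⟩, fun x p q => rfl⟩
  · refine eq_of_forall_character fun χ => ?_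
    rw [map_zero, ← t.charHomeo.symm_apply_apply χ]
    exact DFunLike.congr_fun hx (t.charHomeo χ)
  · obtain ⟨x, hx⟩ := gelfandZeroAtInfty_bijective.2
      (⟨⟨fun χ => g (t.charHomeo χ), by fun_prop⟩, (zero_at_infty g).comp
        t.charHomeo.isClosedEmbedding.tendsto_cocompact⟩ : C₀(characterSpace ℂ T, ℂ))
    refine ⟨x, DFunLike.ext _ _ fun z => ?_⟩
    refine (DFunLike.congr_fun hx (e z)).trans ?_
    exact congrArg g (t.charHomeo.apply_symm_apply z)

end Convolution


theorem theorem1p9 {A : Type u} {T : Type v} {S : Type w} [NonUnitalCommCStarAlgebra A]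
    [Nontrivial A] [NonUnitalCStarAlgebra T] [NonUnitalCStarAlgebra S]
    (t : CStarTensor A A T) (t₃ : CStarTripleTensor t S)
    (Δ : A →⋆ₙₐ[ℂ] 𝓜(ℂ, T)) (hΔ : IsComultiplication t t₃ Δ)
    -- `Δ(A)(1 ⊗ A)` and `Δ(A)(A ⊗ 1)` are contained in `A ⊗̄ A`
    (hright : ∀ a b : A, ∃ x : T, Δ a * t.mult 1 (b : 𝓜(ℂ, A)) = (x : 𝓜(ℂ, T)))
    (hleft : ∀ a b : A, ∃ x : T, Δ a * t.mult (b : 𝓜(ℂ, A)) 1 = (x : 𝓜(ℂ, T)))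
    -- the two injectivity conditions
    (hright_inj : ∀ a b : A, Δ a * t.mult 1 (b : 𝓜(ℂ, A)) = 0 → a ⊗ₜ[ℂ] b = 0)
    (hleft_inj : ∀ a b : A, Δ a * t.mult (b : 𝓜(ℂ, A)) 1 = 0 → a ⊗ₜ[ℂ] b = 0) :
    ∃ (G : Type u) (_ : Group G) (_ : TopologicalSpace G) (_ : IsTopologicalGroup G)
      (_ : LocallyCompactSpace G) (_ : T2Space G)
      (φ : A ≃⋆ₐ[ℂ] C₀(G, ℂ)) (ψ : T ≃⋆ₐ[ℂ] C₀(G × G, ℂ)),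
      -- `ψ` is the identification of `A ⊗̄ A` with `C₀(G × G)` induced by `φ`
      (∀ (a b : A) (p q : G), ψ (t.incl (a ⊗ₜ b)) (p, q) = φ a p * φ b q) ∧
      -- `Δ(a)` is the multiplier given by the bounded function `(p, q) ↦ (φ a)(p q)`
      (∀ (a : A) (x : T) (p q : G), ψ ((Δ a).fst x) (p, q) = φ a (p * q) * ψ x (p, q)) := by
  have hD := hΔ.nondegenerate
  have hne : Nonempty (characterSpace ℂ A) := by
    obtain ⟨a, ha⟩ := exists_ne (0 : A)
    exact ⟨(exists_character_ne_zero ha).choose⟩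
  obtain ⟨hproper, hsurj⟩ := hD.isProperMap_surjective_shear_right hright hright_inj
  obtain ⟨grp, htop, hmul⟩ := exists_group_of_shear hD.conv hΔ.conv_assoc hproper hsurj
    (hD.isProperMap_surjective_shear_left hleft hleft_inj).2
  obtain ⟨ψ, hψ⟩ := t.exists_starAlgEquiv
  refine ⟨characterSpace ℂ A, grp, inferInstance, htop, inferInstance, inferInstance,
    StarAlgEquiv.ofBijective (gelfandZeroAtInfty A) gelfandZeroAtInfty_bijective, ψ,
    fun a b p q => ?_, fun a x p q => ?_⟩
  · rw [hψ, t.prodChar_apply_incl]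
    rfl
  · rw [hψ, hψ, apply_fst, hmul]
    rfl
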